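/- Let $\mathcal Z$ be a measurable space, $\mathcal P$ a set of probability measures on $\mathcal Z$, $\Theta$ a parameter space, and $m_\theta:\mathcal Z\to\mathbb R$ $(\theta\in\Theta)$ measurable loss functions, integrable under every $P\in\mathcal P$, with $$\|m_{\theta_1}-m_{\theta_2}\|_\infty\le B_0\qquad\text{for all }\theta_1,\theta_2\in\Theta .$$ Put $\mathbb M(\theta,P)=\int m_\theta\,dP$ and let $\theta(P)\subseteq\Theta$ be the (possibly non-unique, possibly empty) set of minimizers of $\theta\mapsto\mathbb M(\theta,P)$. For each $P\in\mathcal P$ let $\mathbb P_P$ be a probability measure under which the sample $D_2=(Z_1,\dots,Z_n)$, $n\ge 1$, is IID with distribution $P$ and is independent of a further finite sample $D_1$. Let $\widehat\theta_1=\widehat\theta_1(D_1)\in\Theta$ be an arbitrary initial estimator computed from $D_1$ (measurable in the sense that $(d_1,z)\mapsto m_{\widehat\theta_1(d_1)}(z)$ is measurable). Let $\alpha_1,\alpha_2\in(0,1)$, and let $U(\theta,\theta_1;D_2)\in\mathbb R$ be an upper confidence bound such that for all $P\in\mathcal P$ and $\theta^*\in\theta(P)$, $$\mathbb P_P\big(\mathbb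 M(\theta^*,P)-\mathbb M(\widehat\theta_1,P)\le U(\theta^*,\widehat\theta_1;D_2)\,\big|\,D_1\big)\ge 1-\alpha_2\quad\text{almost surely}$$ (for example $U\equiv 0$). Write $\mathbb P_nf=\frac1n\sum_{i=1}^n f(Z_i)$ and $\widehat\sigma^2_{\theta,\theta_1}=\frac1{n-1}\sum_{i=1}^n\{(m_\theta-m_{\theta_1})(Z_i)-\mathbb P_n(m_\theta-m_{\theta_1})\}^2$, and define the empirical Bernstein confidence set $$\widehat{\mathrm{CI}}^{\mathrm{E.B.}}_{n,\alpha}=\Big\{\theta\in\Theta:\ \mathbb P_n(m_\theta-m_{\widehat\theta_1})\le\sqrt{\tfrac{2\widehat\sigma^2_{\theta,\widehat\theta_1}\log(2/\alpha_1)}{n}}+\tfrac{7B_0\log(2/\alpha_1)}{3(n-1)}+\min\{0,U(\theta,\widehat\theta_1;D_2)\}\Big\},$$ where for $n=1$ the sum of the first two terms on the right is read as $+\infty$ (so that the set is $\Theta$). Then for every $n\ge1$, $$\inf_{P\in\mathcal P}\ \inf_{\theta^*\in\theta(P)}\ \mathbb P_P\big(\theta^*\in\widehat{\mathrm{CI}}^{\mathrm{E.B.}}_{n,\alpha}\big)\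 \ge\ 1-\alpha_1-\alpha_2 .$$ -/

import Mathlib

open MeasureTheory ProbabilityTheory
open scoped ENNReal

noncomputable section

namespace MEstimation

variable {𝒵 Θ Ω : Type*}

/-- The population criterion `M(θ, P) = ∫ m_θ dP`. -/
def risk [MeasurableSpace 𝒵] (m : Θ → 𝒵 → ℝ) (P : Measure 𝒵) (θ : Θ) : ℝ :=
  ∫ z, m θ z ∂P

/-- `θ(P)`, the set of all minimizers over `Θ` of `θ ↦ M(θ, P)`. -/
def argminRisk [MeasurableSpace 𝒵] (m : Θ → 𝒵 → ℝ) (P : Measure 𝒵) : Set Θ :=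
  {θ | ∀ θ' : Θ, risk m P θ ≤ risk m P θ'}

/-- `C_P(θ) = M(θ, P) - M(θ*, P)`, where `θ*` is a minimizer. -/
def excessRisk [MeasurableSpace 𝒵] (m : Θ → 𝒵 → ℝ) (P : Measure 𝒵) (θstar θ : Θ) : ℝ :=
  risk m P θ - risk m P θstar

/-- The empirical mean `ℙ_n f = n⁻¹ ∑ f(Z_i)` over the data set `d = (Z_1, …, Z_n)`. -/
def empMean {n : ℕ} (d : Fin n → 𝒵) (f : 𝒵 → ℝ) : ℝ :=
  (n : ℝ)⁻¹ * ∑ i, f (d i)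

/-- The sample variance of `f` over `d`, with the factor `1 / (n - 1)` (used for `n ≥ 2`). -/
def sampleVar {n : ℕ} (d : Fin n → 𝒵) (f : 𝒵 → ℝ) : ℝ :=
  1 / ((n : ℝ) - 1) * ∑ i, (f (d i) - empMean d f) ^ 2

/-- The empirical Bernstein radius for the function `f`, sup-norm bound `B₀` and level `α₁`:
`√(2 σ̂² log(2/α₁) / n) + 7 B₀ log(2/α₁) / (3 (n - 1))`. For `n = 1`, where the formula has
`n - 1 = 0` in its denominators, it is `+∞`. -/
def ebRadius {n : ℕ} (B₀ α₁ : ℝ) (d : Fin n → 𝒵) (f : 𝒵 → ℝ) : EReal :=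
  if n ≤ 1 then ⊤
  else ((Real.sqrt (2 * sampleVar d f * Real.log (2 / α₁) / n)
    + 7 * B₀ * Real.log (2 / α₁) / (3 * ((n : ℝ) - 1)) : ℝ) : EReal)

/-- The empirical Bernstein confidence set computed from the initial point `θ₁` and the
inferential data `d`; `U θ θ₁ d` is the upper confidence bound. -/
def ebConfidenceSet {n : ℕ} (m : Θ → 𝒵 → ℝ) (B₀ α₁ : ℝ) (U : Θ → Θ → (Fin n → 𝒵) → ℝ)
    (θ₁ : Θ) (d : Fin n → 𝒵) : Set Θ :=
  {θ | ((empMean d (fun z => m θ z - m θ₁ z) : ℝ) : EReal)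
      ≤ ebRadius B₀ α₁ d (fun z => m θ z - m θ₁ z) + ((min 0 (U θ θ₁ d) : ℝ) : EReal)}

/-- Under the probability measure `μ`, the inferential sample `D₂` is IID with distribution `P`
and is independent of the first sample `D₁`. (In particular this holds if `D₁` and `D₂` come from
splitting one IID sample.) -/
structure IsSplitSample [MeasurableSpace Ω] [MeasurableSpace 𝒵] {n₁ n : ℕ}
    (D₁ : Fin n₁ → Ω → 𝒵) (D₂ : Fin n → Ω → 𝒵) (μ : Measure Ω) (P : Measure 𝒵) : Prop where
  measurable_fst : ∀ i, Measurable (D₁ i)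
  measurable_snd : ∀ i, Measurable (D₂ i)
  law_snd : ∀ i, μ.map (D₂ i) = P
  iIndep_snd : iIndepFun D₂ μ
  indep : IndepFun (fun ω i => D₁ i ω) (fun ω i => D₂ i ω) μ

/-- The σ-algebra generated by a data set. -/
abbrev dataSigma [MeasurableSpace 𝒵] {k : ℕ} (D : Fin k → Ω → 𝒵) : MeasurableSpace Ω :=
  MeasurableSpace.comap (fun ω i => D i ω) inferInstance

/-- The requirement `ℙ_P(-C_P(θ̂₁) ≤ U(θ*, θ̂₁; D₂) | D₁) ≥ 1 - α₂` almost surely, for every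
`P ∈ 𝓟` and every `θ* ∈ θ(P)`. -/
def IsUpperConfidenceBound [MeasurableSpace Ω] [MeasurableSpace 𝒵] {n₁ n : ℕ}
    (m : Θ → 𝒵 → ℝ) (𝓟 : Set (ProbabilityMeasure 𝒵)) (Pr : ProbabilityMeasure 𝒵 → Measure Ω)
    (D₁ : Fin n₁ → Ω → 𝒵) (D₂ : Fin n → Ω → 𝒵) (θhat : (Fin n₁ → 𝒵) → Θ)
    (U : Θ → Θ → (Fin n → 𝒵) → ℝ) (α₂ : ℝ) : Prop :=
  ∀ P ∈ 𝓟, ∀ θstar ∈ argminRisk m (P : Measure 𝒵), ∀ᵐ ω ∂(Pr P),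
    1 - α₂ ≤ ((Pr P)⟦{ω' | - excessRisk m (P : Measure 𝒵) θstar (θhat (fun i => D₁ i ω'))
      ≤ U θstar (θhat (fun i => D₁ i ω')) (fun i => D₂ i ω')} | dataSigma D₁⟧) ω

end MEstimation

end

/-! Fix `P` and a minimizer `θstar`, and put `F = m θstar - m θhat`. Given `D₁`, `F` takes values in
`[-B, B]` and its mean `-excessRisk` is at most `0`. On the event `E` that `U` is valid, the mean is
thus at most `min 0 U`, so `θstar` can be missed only if `E` fails or the empirical mean exceeds the
true mean by more than the radius.

The latter has probability at most `α₁` (`measure_realRadius_lt_le`). With `c` the mean of `F`, the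
variable `ξ = (F - c) / B` lies in `[-1, 2]`, is centred and has variance at most `1`; the sign of
`c` gives `-1` instead of `-2`, which is why `7 B` suffices although `F` has range `2 B`. Let `L =
log (2 / α₁)` and `S = ∑ ξ`. Exceeding the radius forces `Deviates`: `S` is large relative to the
sample variance.

`deviates_le` splits this event at Bernstein's threshold `L (√2 r + 2/3)`, where `L r²` is the
larger of `L` and the variance of `S`. Above it, Bernstein costs `exp (-L)`. Below it, the sample
variance must be small, and a Chernoff bound for a function of `ξ` penalising large `ξ²` again costs
`exp (-L)`. Three ranges of `r` need three such functions. -/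

noncomputable section

namespace EmpiricalBernstein

/-! ### Scalar inequalities for `exp` and `log`. -/

/-- A function that is nonnegative at `0` and has nonnegative derivative on `[0, b]` is nonnegative
at `b`. -/
theorem nonneg_of_hasDerivAt_nonneg {f f' : ℝ → ℝ} {b : ℝ} (hb : 0 ≤ b) (h0 : 0 ≤ f 0)
    (hd : ∀ x ∈ Set.Icc 0 b, HasDerivAt f (f' x) x) (hn : ∀ x ∈ Set.Icc 0 b, 0 ≤ f' x) :
    0 ≤ f b := by
  have hmono : MonotoneOn f (Set.Icc 0 b) := by
    refine monotoneOn_of_deriv_nonneg (convex_Icc 0 b)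
      (fun x hx => (hd x hx).continuousAt.continuousWithinAt) ?_ ?_
    · intro x hx
      exact (hd x (interior_subset hx)).differentiableAt.differentiableWithinAt
    · intro x hx
      rw [(hd x (interior_subset hx)).deriv]
      exact hn x (interior_subset hx)
  exact h0.trans (hmono ⟨le_rfl, hb⟩ ⟨hb, le_rfl⟩ hb)

/-- The difference of logarithms vanishes at `0` and its derivative has the sign of `x³`, so it is
minimal there. The right side equals `1 + u + u² / (2 (1 - u/3))`, Bernstein's form before `u` is
replaced by its upper bound in the denominator. -/
theorem exp_le_pade {u : ℝ} (hu : u < 3) : Real.exp u ≤ (6 + 4 * u + u ^ 2) / (6 - 2 * u) := by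
  have hpos : ∀ x : ℝ, 0 < 6 + 4 * x + x ^ 2 := fun x => by nlinarith [sq_nonneg (x + 2)]
  suffices h : 0 ≤ Real.log (6 + 4 * u + u ^ 2) - Real.log (6 - 2 * u) - u by
    rw [← Real.le_log_iff_exp_le (div_pos (hpos u) (by linarith)),
      Real.log_div (hpos u).ne' (by linarith)]
    linarith
  have hd : ∀ x : ℝ, x < 3 → HasDerivAt
      (fun x : ℝ => Real.log (6 + 4 * x + x ^ 2) - Real.log (6 - 2 * x) - x)
      (2 * x ^ 3 / ((6 + 4 * x + x ^ 2) * (6 - 2 * x))) x := by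
    intro x hx
    have h1 : HasDerivAt (fun x : ℝ => 6 + 4 * x + x ^ 2) (4 + 2 * x) x := by
      have := (((hasDerivAt_id x).const_mul 4).const_add 6).add ((hasDerivAt_id x).pow 2)
      exact this.congr_deriv (by simp)
    have h2 : HasDerivAt (fun x : ℝ => 6 - 2 * x) (-2) x := by
      have := ((hasDerivAt_id x).const_mul 2).const_sub 6
      exact this.congr_deriv (by simp)
    have h3 : (6 - 2 * x) ≠ 0 := by linarith
    refine HasDerivAt.congr_deriv (((h1.log (hpos x).ne').sub (h2.log h3)).sub (hasDerivAt_id x)) ?_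
    have := (hpos x).ne'
    field_simp
    ring
  rcases le_total 0 u with h0 | h0
  · refine nonneg_of_hasDerivAt_nonneg (f := fun x : ℝ =>
      Real.log (6 + 4 * x + x ^ 2) - Real.log (6 - 2 * x) - x) h0 (by simp)
      (fun x hx => hd x (by linarith [hx.2])) (fun x hx => ?_)
    have := hx.1
    exact div_nonneg (by positivity) (mul_nonneg (hpos x).le (by linarith [hx.2]))
  · have := nonneg_of_hasDerivAt_nonneg (b := -u) (f := fun y : ℝ =>
      Real.log (6 + 4 * (-y) + (-y) ^ 2) - Real.log (6 - 2 * (-y)) - (-y)) (by linarith) (by simp)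
      (fun x hx => (hd (-x) (by linarith [hx.1])).scomp x (hasDerivAt_neg x)) (fun x hx => ?_)
    · simpa only [neg_neg] using this
    · have h1 := hx.1
      have h2 := hpos (-x)
      have h3 : 0 < 6 - 2 * (-x) := by linarith
      have h4 : 0 ≤ x ^ 3 := by positivity
      rw [smul_eq_mul, show (-1 : ℝ) * (2 * (-x) ^ 3 / ((6 + 4 * -x + (-x) ^ 2) * (6 - 2 * -x)))
        = 2 * x ^ 3 / ((6 + 4 * -x + (-x) ^ 2) * (6 - 2 * -x)) by ring]
      positivity

/-- The exponential bound behind Bernstein's inequality. -/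
theorem exp_le_of_le {u b : ℝ} (hub : u ≤ b) (hb : b < 3) :
    Real.exp u ≤ 1 + u + u ^ 2 / (2 * (1 - b / 3)) := by
  refine (exp_le_pade (hub.trans_lt hb)).trans ?_
  have h1 : (0 : ℝ) < 2 * (1 - b / 3) := by linarith
  have h2 : (0 : ℝ) < 2 * (1 - u / 3) := by linarith
  have h3 : (6 + 4 * u + u ^ 2) / (6 - 2 * u) = 1 + u + u ^ 2 / (2 * (1 - u / 3)) := by
    have h4 : 6 - 2 * u ≠ 0 := by linarith
    rw [show 2 * (1 - u / 3) = (6 - 2 * u) / 3 by ring, div_div_eq_mul_div, div_eq_iff h4, add_mul,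
      div_mul_cancel₀ _ h4]
    ring
  rw [h3]
  gcongr

/-- Fan's inequality: a quadratic lower bound of `log (1 + l x)` for `x ≥ -1`. -/
theorem fan_le_log {l x : ℝ} (hl0 : 0 ≤ l) (hl1 : l < 1) (hx : -1 ≤ x) :
    l * x + (Real.log (1 - l) + l) * x ^ 2 ≤ Real.log (1 + l * x) := by
  have hp : ∀ t ∈ Set.Icc 0 l, 0 < 1 + t * x := fun t ht => by nlinarith [ht.1, ht.2]
  have := nonneg_of_hasDerivAt_nonneg (b := l) (f := fun t : ℝ =>
      Real.log (1 + t * x) - t * x - (Real.log (1 - t) + t) * x ^ 2)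
      (f' := fun t => t * x ^ 2 * (1 / (1 - t) - 1 / (1 + t * x))) hl0 (by simp)
      (fun t ht => ?_) (fun t ht => ?_)
  · linarith
  · have h1 : HasDerivAt (fun t : ℝ => 1 + t * x) x t := by
      have := ((hasDerivAt_id t).mul_const x).const_add 1
      exact this.congr_deriv (by simp)
    have h1' : HasDerivAt (fun t : ℝ => t * x) x t := by
      have := ((hasDerivAt_id t).mul_const x)
      exact this.congr_deriv (by simp)
    have h2 : HasDerivAt (fun t : ℝ => 1 - t) (-1) t := (hasDerivAt_id t).const_sub 1
    have h3 : 1 - t ≠ 0 := by linarith [ht.2]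
    have h4 := (hp t ht).ne'
    refine HasDerivAt.congr_deriv
      (((h1.log h4).sub h1').sub (((h2.log h3).add (hasDerivAt_id t)).mul_const (x ^ 2))) ?_
    have h7 : x / (1 + t * x) = x - t * x ^ 2 * (1 / (1 + t * x)) := by
      rw [div_eq_iff h4, sub_mul, mul_assoc, div_mul_cancel₀ _ h4]
      ring
    have h8 : t * (1 / (1 - t)) = 1 / (1 - t) - 1 := by
      rw [eq_sub_iff_add_eq, mul_one_div, div_add_one h3]
      ring
    rw [neg_div]
    linear_combination h7 - x ^ 2 * h8
  · have h3 : 0 < 1 - t := by linarith [ht.2]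
    have h5 := ht.1
    refine mul_nonneg (by positivity) (sub_nonneg.2 (one_div_le_one_div_of_le h3 ?_))
    nlinarith

/-- A version of Fan's inequality with the quadratic centred at `c ≥ 0`. -/
theorem fan_centred_le_log {l A c x : ℝ} (hl0 : 0 ≤ l) (hl1 : l < 1) (hx : -1 ≤ x) (hc : 0 ≤ c)
    (hA1 : l ^ 2 ≤ A) (hA2 : -(Real.log (1 - l) + l) ≤ A) :
    Real.log (1 + l * c) + l * (x - c) / (1 + l * c) - A * (x - c) ^ 2 ≤ Real.log (1 + l * x) := by
  have hlc : 0 ≤ l * c := mul_nonneg hl0 hc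
  have hc1 : 0 < 1 + l * c := by linarith
  have hx1 : 0 < 1 + l * x := by nlinarith
  rcases le_total x 0 with h | h
  · have h1 := fan_le_log hl0 hl1 hx
    have h2 : Real.log (1 + l * c) ≤ l * c := by linarith [Real.log_le_sub_one_of_pos hc1]
    have h3 : l * (x - c) / (1 + l * c) ≤ l * x - l * c + (l * c) ^ 2 - l ^ 2 * c * x := by
      rw [div_le_iff₀ hc1]
      have h5 : 0 ≤ l ^ 2 * c ^ 2 * (l * (c - x)) :=
        mul_nonneg (by positivity) (mul_nonneg hl0 (by linarith))
      nlinarith [h5]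
    have h4 : 0 ≤ (A + (Real.log (1 - l) + l)) * x ^ 2 := mul_nonneg (by linarith) (sq_nonneg x)
    have h6 : 0 ≤ (A - l ^ 2) * (c ^ 2 - c * x) :=
      mul_nonneg (by linarith) (by nlinarith)
    have h7 : 0 ≤ A * (c * -x) :=
      mul_nonneg (by nlinarith [sq_nonneg l]) (mul_nonneg hc (by linarith))
    nlinarith [h6, h7, h4]
  -- For `x ≥ 0`, use `log t ≥ 1 - 1/t` at this ratio. The error is at most `l² (x - c)²`, hence the
  -- requirement `l² ≤ A`.
  · have h0 : 0 < (1 + l * x) / (1 + l * c) := div_pos hx1 hc1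
    have h1 := Real.one_sub_inv_le_log_of_pos h0
    rw [Real.log_div hx1.ne' hc1.ne', inv_div] at h1
    have h2 : l * (x - c) / (1 + l * c) - A * (x - c) ^ 2 ≤ 1 - (1 + l * c) / (1 + l * x) := by
      have h3 : l * (x - c) / (1 + l * c) - (1 - (1 + l * c) / (1 + l * x))
          = l ^ 2 * (x - c) ^ 2 / ((1 + l * c) * (1 + l * x)) := by
        field_simp
        ring
      have h4 : l ^ 2 * (x - c) ^ 2 / ((1 + l * c) * (1 + l * x)) ≤ A * (x - c) ^ 2 := by
        refine (div_le_self (by positivity) ?_).trans (by gcongr)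
        nlinarith [mul_nonneg hl0 h, mul_nonneg hlc (mul_nonneg hl0 h)]
      linarith
    linarith

/-- With the next lemma this yields `exp (u - (1 + 7/4 l) u²) ≤ 1 + u - u²/2` for `-l ≤ u ≤ 2`, as
needed when `r` is large. -/
theorem sub_sq_le_log {u : ℝ} (h0 : 0 ≤ u) (h2 : u ≤ 2) :
    u - u ^ 2 ≤ Real.log (1 + u - u ^ 2 / 2) := by
  have hp : ∀ t ∈ Set.Icc 0 u, 0 < 1 + t - t ^ 2 / 2 := fun t ht => by nlinarith [ht.1, ht.2]
  have := nonneg_of_hasDerivAt_nonneg (b := u) (f := fun t : ℝ =>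
      Real.log (1 + t - t ^ 2 / 2) - t + t ^ 2)
      (f' := fun t => t ^ 2 * (5 / 2 - t) / (1 + t - t ^ 2 / 2)) h0 (by simp)
      (fun t ht => ?_) (fun t ht => ?_)
  · linarith
  · have h1 : HasDerivAt (fun t : ℝ => 1 + t - t ^ 2 / 2) (1 - t) t := by
      have := ((hasDerivAt_id t).const_add 1).sub (((hasDerivAt_id t).pow 2).div_const 2)
      exact this.congr_deriv (by simp)
    have h3 : HasDerivAt (fun t : ℝ => t ^ 2) (2 * t) t := by
      simpa using hasDerivAt_pow 2 t
    have h4 := (hp t ht).ne'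
    refine HasDerivAt.congr_deriv (((h1.log h4).sub (hasDerivAt_id t)).add h3) ?_
    rw [eq_div_iff h4, add_mul, sub_mul, div_mul_cancel₀ _ h4]
    ring
  · exact div_nonneg (mul_nonneg (sq_nonneg t) (by linarith [ht.2])) (hp t ht).le

theorem neg_sub_sq_sub_cube_le_log {w : ℝ} (h0 : 0 ≤ w) (h2 : w ≤ 3 / 8) :
    -w - w ^ 2 - 7 / 4 * w ^ 3 ≤ Real.log (1 - w - w ^ 2 / 2) := by
  have hp : ∀ t ∈ Set.Icc 0 w, 0 < 1 - t - t ^ 2 / 2 := fun t ht => by nlinarith [ht.1, ht.2]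
  have := nonneg_of_hasDerivAt_nonneg (b := w) (f := fun t : ℝ =>
      Real.log (1 - t - t ^ 2 / 2) + t + t ^ 2 + 7 / 4 * t ^ 3)
      -- The bracket in the derivative is still positive at `t = 3/8`, which fixes the range of `w`.
      (f' := fun t => t ^ 2 * (11 / 4 - 25 / 4 * t - 21 / 8 * t ^ 2) / (1 - t - t ^ 2 / 2)) h0
      (by simp) (fun t ht => ?_) (fun t ht => ?_)
  · linarith
  · have h1 : HasDerivAt (fun t : ℝ => 1 - t - t ^ 2 / 2) (-1 - t) t := by
      have := ((hasDerivAt_id t).const_sub 1).sub (((hasDerivAt_id t).pow 2).div_const 2)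
      exact this.congr_deriv (by simp)
    have h3 : HasDerivAt (fun t : ℝ => t ^ 2) (2 * t) t := by
      simpa using hasDerivAt_pow 2 t
    have h5 : HasDerivAt (fun t : ℝ => 7 / 4 * t ^ 3) (7 / 4 * (3 * t ^ 2)) t := by
      simpa using (hasDerivAt_pow 3 t).const_mul (7 / 4)
    have h4 := (hp t ht).ne'
    refine HasDerivAt.congr_deriv ((((h1.log h4).add (hasDerivAt_id t)).add h3).add h5) ?_
    rw [eq_div_iff h4, add_mul, add_mul, add_mul, div_mul_cancel₀ _ h4]
    ring
  · exact div_nonneg (mul_nonneg (sq_nonneg t) (by nlinarith [ht.1, ht.2])) (hp t ht).le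

/-! ### Exponential moments. -/

/-- A Chernoff bound for sums of a function whose exponential is dominated by a quadratic
polynomial in a bounded centred function. -/
theorem chernoff_of_exp_le {𝒵 : Type*} [MeasurableSpace 𝒵] {n : ℕ} (P : Measure 𝒵)
    [IsProbabilityMeasure P] {φ ξ : 𝒵 → ℝ} (hφ : Measurable φ) (hξ : Measurable ξ) {C : ℝ}
    (hC : ∀ z, |ξ z| ≤ C) (h0 : ∫ z, ξ z ∂P = 0) {l k M K : ℝ}
    (hle : ∀ z, Real.exp (φ z) ≤ 1 + l * ξ z + k * ξ z ^ 2)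
    (hM : n * (k * ∫ z, ξ z ^ 2 ∂P) ≤ M) :
    (Measure.pi fun _ : Fin n => P).real {d | K ≤ ∑ i, φ (d i)} ≤ Real.exp (M - K) := by
  have hi1 : Integrable ξ P :=
    Integrable.of_bound hξ.aestronglyMeasurable C (Filter.Eventually.of_forall hC)
  have hi2 : Integrable (fun z => ξ z ^ 2) P := by
    refine Integrable.of_bound (hξ.pow_const 2).aestronglyMeasurable (C ^ 2)
      (Filter.Eventually.of_forall fun z => ?_)
    rw [Real.norm_eq_abs, abs_pow]
    exact pow_le_pow_left₀ (abs_nonneg _) (hC z) 2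
  have hi3 : Integrable (fun z => 1 + l * ξ z + k * ξ z ^ 2) P :=
    ((integrable_const _).add (hi1.const_mul l)).add (hi2.const_mul k)
  have hi4 : Integrable (fun z => Real.exp (φ z)) P := by
    refine hi3.mono' (Real.measurable_exp.comp hφ).aestronglyMeasurable
      (Filter.Eventually.of_forall fun z => ?_)
    rw [Real.norm_eq_abs, abs_of_pos (Real.exp_pos _)]
    exact hle z
  -- The coefficient `k` may be negative; the exponential moment then decays with the variance.
  have hint : ∫ z, Real.exp (φ z) ∂P ≤ Real.exp (k * ∫ z, ξ z ^ 2 ∂P) := by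
    calc ∫ z, Real.exp (φ z) ∂P ≤ ∫ z, (1 + l * ξ z + k * ξ z ^ 2) ∂P :=
          integral_mono hi4 hi3 hle
      _ = k * ∫ z, ξ z ^ 2 ∂P + 1 := by
          have hi5 : Integrable (fun z => 1 + l * ξ z) P :=
            (integrable_const _).add (hi1.const_mul l)
          rw [integral_add hi5 (hi2.const_mul k),
            integral_add (integrable_const _) (hi1.const_mul l), integral_const_mul,
            integral_const_mul, h0]
          simp [add_comm]
      _ ≤ _ := Real.add_one_le_exp _
  have hmarkov := mul_meas_ge_le_integral_of_nonneg (μ := Measure.pi fun _ : Fin n => P)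
    (f := fun d => ∏ i, Real.exp (φ (d i)))
    (Filter.Eventually.of_forall fun d => Finset.prod_nonneg fun i _ => (Real.exp_pos _).le)
    (Integrable.fintype_prod fun _ => hi4) (Real.exp K)
  rw [integral_fintype_prod_eq_pow (fun z => Real.exp (φ z)), Fintype.card_fin] at hmarkov
  have hset : {d : Fin n → 𝒵 | K ≤ ∑ i, φ (d i)}
      = {d | Real.exp K ≤ ∏ i, Real.exp (φ (d i))} := by
    ext d
    simp only [Set.mem_ofPred_eq]
    rw [← Real.exp_sum, Real.exp_le_exp]
  rw [hset, Real.exp_sub, le_div_iff₀ (Real.exp_pos K), mul_comm]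
  refine hmarkov.trans ?_
  calc (∫ z, Real.exp (φ z) ∂P) ^ n ≤ Real.exp (k * ∫ z, ξ z ^ 2 ∂P) ^ n :=
        pow_le_pow_left₀ (integral_nonneg fun z => (Real.exp_pos _).le) hint n
    _ = Real.exp (n * (k * ∫ z, ξ z ^ 2 ∂P)) := (Real.exp_nat_mul _ n).symm
    _ ≤ _ := Real.exp_le_exp.2 hM

/-! ### Deterministic inequalities in `s = S / L`, `y = V / L`, `N = n / L`, with `V` the centred
sum of squares. -/

/-- Replacing `y` by its bound leaves a concave function of `s`, so the two endpoints decide. The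
upper one dominates `√2 * 2.4 + 2/3`. -/
theorem half_log_le_of_small {s y : ℝ} (h1 : 7 / 3 ≤ s) (h2 : s ≤ 4.061)
    (hy : 2 * y ≤ (s - 7 / 3) ^ 2) : 1 ≤ s / 2 * Real.log 2.4 - 0.51 * y := by
  have h3 : (0.874 : ℝ) ≤ Real.log 2.4 := by
    have h4 : Real.log 2.4 = Real.log 2 + Real.log 1.2 := by
      rw [← Real.log_mul (by norm_num) (by norm_num)]; norm_num
    have h5 : (0.181 : ℝ) ≤ Real.log 1.2 := by
      have := Real.le_log_one_add_of_nonneg (x := (0.2 : ℝ)) (by norm_num)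
      norm_num at this ⊢
      linarith
    linarith [Real.log_two_gt_d9]
  nlinarith [mul_nonneg (sub_nonneg.2 h1) (sub_nonneg.2 h2),
    mul_le_mul_of_nonneg_left h3 (show 0 ≤ s / 2 by linarith)]

/-- Here `y + s² / N` is the normalized uncentred sum of squares. For `s ≤ 4.06`, `N ≥ 2.4²`
suffices; for larger `s`, the bound `s ≤ √2 r + 2/3` forces `r`, hence `N`, to be larger. -/
theorem quadratic_le_of_medium {r s y N : ℝ} (hr1 : 2.4 ≤ r) (hr2 : r ≤ 3.8) (hN : r ^ 2 ≤ N)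
    (h1 : 7 / 3 ≤ s) (h2 : s ≤ √2 * r + 2 / 3) (hy : 2 * y ≤ (s - 7 / 3) ^ 2) :
    1 ≤ 0.52 * s - 0.215 * (y + s ^ 2 / N) := by
  have hq : √2 ^ 2 = 2 := Real.sq_sqrt (by norm_num)
  have hq0 : 0 ≤ √2 := Real.sqrt_nonneg 2
  have hq1 : √2 ≤ 1.4143 := by nlinarith
  have hN0 : 5.76 ≤ N := by nlinarith
  have h3 : s ≤ 6.0411 := by nlinarith
  rcases le_total s 4.06 with h | h
  · have h4 : s ^ 2 / N ≤ s ^ 2 / 5.76 := by gcongr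
    have h5 : 0 ≤ (s - 7 / 3) * (4.06 - s) := mul_nonneg (sub_nonneg.2 h1) (sub_nonneg.2 h)
    have h6 : s ^ 2 / 5.76 = s ^ 2 * (25 / 144) := by norm_num; ring
    rw [h6] at h4
    nlinarith
  · have h4 : s ^ 2 / N ≤ 2.87 := by
      rw [div_le_iff₀ (by linarith)]
      have h5 : (s - 2 / 3) ^ 2 ≤ 2 * r ^ 2 := by
        calc (s - 2 / 3) ^ 2 ≤ (√2 * r) ^ 2 := pow_le_pow_left₀ (by linarith) (by linarith) 2
          _ = 2 * r ^ 2 := by rw [mul_pow, hq]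
      nlinarith
    nlinarith [mul_nonneg (sub_nonneg.2 h3) (sub_nonneg.2 h)]

/-- In the variable `u = l s` with `l = √2 / r`, the quadratic part divided by `u` is largest at the
upper end `u = 2 + 2/3 l`. A polynomial inequality in `l` remains. -/
theorem quadratic_nonneg_of_large {r s y N : ℝ} (hr : 3.8 ≤ r) (hN : r ^ 2 ≤ N)
    (h1 : 7 / 3 ≤ s) (h2 : s ≤ √2 * r + 2 / 3) (hy : 2 * y ≤ (s - 7 / 3) ^ 2) :
    0 ≤ √2 / r * s - (1 + 7 / 4 * (√2 / r)) * (√2 / r) ^ 2 * (y + s ^ 2 / N) := by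
  have hq : √2 ^ 2 = 2 := Real.sq_sqrt (by norm_num)
  have hq0 : 0 < √2 := Real.sqrt_pos.2 (by norm_num)
  have hq1 : √2 ≤ 1.4143 := by nlinarith
  have hr0 : 0 < r := by linarith
  set l := √2 / r with hl
  have hl0 : 0 < l := div_pos hq0 hr0
  have hl1 : l ≤ 0.3722 := by rw [hl, div_le_iff₀ hr0]; linarith
  have hlr : l * r = √2 := div_mul_cancel₀ _ hr0.ne'
  have hlr2 : l ^ 2 * r ^ 2 = 2 := by rw [← mul_pow, hlr, hq]
  have h3 : s ^ 2 / N ≤ l ^ 2 * s ^ 2 / 2 := by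
    rw [div_le_div_iff₀ (by nlinarith) (by norm_num), ← hlr2]
    have : l ^ 2 * s ^ 2 * r ^ 2 ≤ l ^ 2 * s ^ 2 * N := by gcongr
    linarith
  set u := l * s with hu
  have hu1 : 7 / 3 * l ≤ u := by rw [hu]; nlinarith
  have hu2 : u ≤ 2 + 2 / 3 * l := by
    have : l * s ≤ l * (√2 * r + 2 / 3) := by gcongr
    nlinarith
  have hkey : (1 + 7 / 4 * l) / 2 * ((u - 7 / 3 * l) ^ 2 + l ^ 2 * u ^ 2) ≤ u := by
    have hU : 0 < 2 + 2 / 3 * l := by linarith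
    have h4 : (u - 7 / 3 * l) ^ 2 * (2 + 2 / 3 * l) ≤ u * (2 - 5 / 3 * l) ^ 2 := by
      have h7 : 7 / 3 * l * (7 / 3 * l) ≤ u * (2 + 2 / 3 * l) :=
        mul_le_mul hu1 (by linarith) (by linarith) (by linarith)
      have : 0 ≤ (2 + 2 / 3 * l - u) * (u * (2 + 2 / 3 * l) - 7 / 3 * l * (7 / 3 * l)) :=
        mul_nonneg (by linarith) (by linarith)
      linarith
    have h5 : l ^ 2 * u ^ 2 * (2 + 2 / 3 * l) ≤ u * (l ^ 2 * (2 + 2 / 3 * l) ^ 2) := by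
      have h7 : 0 ≤ u := by linarith
      have : l ^ 2 * u * (2 + 2 / 3 * l) * u ≤ l ^ 2 * u * (2 + 2 / 3 * l) * (2 + 2 / 3 * l) := by
        gcongr
      linarith
    -- Both sides equal `2` at `l = 0`; to first order the left grows by `7/2 - 10/3 = 1/6` and the
    -- right by `2/3`. The bound on `l` absorbs the higher powers.
    have h6 : (1 + 7 / 4 * l) / 2 * ((2 - 5 / 3 * l) ^ 2 + l ^ 2 * (2 + 2 / 3 * l) ^ 2)
        ≤ 2 + 2 / 3 * l := by
      have h7 : 0 ≤ l ^ 2 := sq_nonneg l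
      have h8 : l ^ 2 ≤ 0.3722 * l := by
        rw [pow_two]; exact mul_le_mul_of_nonneg_right hl1 hl0.le
      have h9 : l ^ 3 ≤ 0.3722 * l ^ 2 := by
        rw [pow_succ']; exact mul_le_mul_of_nonneg_right hl1 h7
      have h10 : l ^ 4 ≤ 0.3722 ^ 2 * l ^ 2 := by
        rw [show l ^ 4 = l ^ 2 * l ^ 2 by ring]
        exact mul_le_mul_of_nonneg_right (pow_le_pow_left₀ hl0.le hl1 2) h7
      have h11 : l ^ 5 ≤ 0.3722 ^ 3 * l ^ 2 := by
        rw [show l ^ 5 = l ^ 3 * l ^ 2 by ring]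
        exact mul_le_mul_of_nonneg_right (pow_le_pow_left₀ hl0.le hl1 3) h7
      norm_num at h8 h9 h10 h11
      linarith
    refine le_of_mul_le_mul_right ?_ hU
    have h12 : 0 ≤ (1 + 7 / 4 * l) / 2 := by linarith
    calc _ = (1 + 7 / 4 * l) / 2 * ((u - 7 / 3 * l) ^ 2 * (2 + 2 / 3 * l)
          + l ^ 2 * u ^ 2 * (2 + 2 / 3 * l)) := by ring
      _ ≤ (1 + 7 / 4 * l) / 2 * (u * (2 - 5 / 3 * l) ^ 2
          + u * (l ^ 2 * (2 + 2 / 3 * l) ^ 2)) := by gcongr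
      _ = u * ((1 + 7 / 4 * l) / 2 * ((2 - 5 / 3 * l) ^ 2 + l ^ 2 * (2 + 2 / 3 * l) ^ 2)) := by
          ring
      _ ≤ _ := mul_le_mul_of_nonneg_left h6 (by linarith)
  have hfin : (1 + 7 / 4 * l) * l ^ 2 * (y + s ^ 2 / N)
      ≤ (1 + 7 / 4 * l) * l ^ 2 * ((s - 7 / 3) ^ 2 / 2 + l ^ 2 * s ^ 2 / 2) := by
    have : 0 ≤ (1 + 7 / 4 * l) * l ^ 2 := by positivity
    exact mul_le_mul_of_nonneg_left (by linarith) this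
  have : (1 + 7 / 4 * l) * l ^ 2 * ((s - 7 / 3) ^ 2 / 2 + l ^ 2 * s ^ 2 / 2)
      = (1 + 7 / 4 * l) / 2 * ((u - 7 / 3 * l) ^ 2 + l ^ 2 * u ^ 2) := by rw [hu]; ring
  linarith

/-- Fan's inequality summed over a sample, with the quadratic centred at the sample mean. -/
theorem sum_fan_le {n : ℕ} (hn : 0 < n) (x : Fin n → ℝ) (h1 : ∀ i, -1 ≤ x i)
    (h2 : ∑ i, x i ≤ 2 * n) (h0 : 0 ≤ ∑ i, x i) :
    (∑ i, x i) / 2 * Real.log 2.4 - 0.51 * (∑ i, x i ^ 2 - (∑ i, x i) ^ 2 / n)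
      ≤ ∑ i, Real.log (1 + 0.7 * x i) := by
  have hn' : (0 : ℝ) < n := by exact_mod_cast hn
  set S := ∑ i, x i with hS
  set c := S / n with hc
  have hc0 : 0 ≤ c := by positivity
  have hc2 : c ≤ 2 := by rw [hc, div_le_iff₀ hn']; exact h2
  have hnc : n * c = S := mul_div_cancel₀ _ hn'.ne'
  -- The constant `0.51` dominates both this quantity and `0.7²`.
  have hlog : -(Real.log (1 - 0.7) + 0.7) ≤ (0.51 : ℝ) := by
    have h3 : Real.log (1 - 0.7) = -Real.log (10 / 3) := by
      rw [← Real.log_inv]; norm_num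
    have h4 : Real.log (10 / 3) ≤ 1.21 := by
      rw [Real.log_le_iff_le_exp (by norm_num), show (1.21 : ℝ) = 1 + 0.21 by norm_num, Real.exp_add]
      have h5 := Real.exp_one_gt_d9
      have h6 := Real.quadratic_le_exp_of_nonneg (x := (0.21 : ℝ)) (by norm_num)
      nlinarith
    linarith
  have hterm : ∀ i, Real.log (1 + 0.7 * c) + 0.7 * (x i - c) / (1 + 0.7 * c)
      - 0.51 * (x i - c) ^ 2 ≤ Real.log (1 + 0.7 * x i) := fun i =>
    fan_centred_le_log (by norm_num) (by norm_num) (h1 i) hc0 (by norm_num) hlog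
  have hsum := Finset.sum_le_sum fun i (_ : i ∈ Finset.univ) => hterm i
  have hlin : ∑ i, (x i - c) = 0 := by
    rw [Finset.sum_sub_distrib, ← hS]; simp [hnc]
  have hsq : ∑ i, (x i - c) ^ 2 = ∑ i, x i ^ 2 - S ^ 2 / n := by
    have : ∀ i, (x i - c) ^ 2 = x i ^ 2 - (2 * c) * x i + c ^ 2 := fun i => by ring
    simp only [this]
    rw [Finset.sum_add_distrib, Finset.sum_sub_distrib, ← Finset.mul_sum, ← hS]
    simp only [Finset.sum_const, Finset.card_univ, Fintype.card_fin, nsmul_eq_mul]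
    rw [hc]
    field_simp
    ring
  rw [Finset.sum_sub_distrib, Finset.sum_add_distrib, ← Finset.mul_sum, ← Finset.sum_div,
    ← Finset.mul_sum, hlin, hsq] at hsum
  simp only [Finset.sum_const, Finset.card_univ, Fintype.card_fin, nsmul_eq_mul] at hsum
  -- Chord of the concave function `log (1 + 0.7 c)` on `[0, 2]`, obtained from Bernoulli's
  -- inequality; `2.4 = 1 + 0.7 * 2`.
  have hconc : c / 2 * Real.log 2.4 ≤ Real.log (1 + 0.7 * c) := by
    rw [← Real.log_rpow (by norm_num)]
    refine Real.log_le_log (by positivity) ?_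
    have := rpow_one_add_le_one_add_mul_self (s := 1.4) (p := c / 2) (by norm_num)
      (by positivity) (by linarith)
    calc (2.4 : ℝ) ^ (c / 2) = (1 + 1.4) ^ (c / 2) := by norm_num
      _ ≤ 1 + c / 2 * 1.4 := this
      _ = 1 + 0.7 * c := by ring
  have := mul_le_mul_of_nonneg_left hconc hn'.le
  have h7 : n * (c / 2 * Real.log 2.4) = S / 2 * Real.log 2.4 := by rw [← hnc]; ring
  rw [mul_zero, zero_div] at hsum
  linarith

/-! ### Tail bounds for the deviation event. -/

/-- The sum of `x` exceeds the empirical Bernstein radius at deviation level `L`, in units where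
the terms are bounded below by `-1`. -/
def Deviates {n : ℕ} (L : ℝ) (x : Fin n → ℝ) : Prop :=
  7 / 3 * L < ∑ i, x i ∧
    2 * L * (∑ i, x i ^ 2 - (∑ i, x i) ^ 2 / n) ≤ (∑ i, x i - 7 / 3 * L) ^ 2

theorem Deviates.normalized {n : ℕ} {L : ℝ} {x : Fin n → ℝ} (h : Deviates L x) (hL : 0 < L) :
    7 / 3 ≤ (∑ i, x i) / L ∧
      2 * ((∑ i, x i ^ 2 - (∑ i, x i) ^ 2 / n) / L) ≤ ((∑ i, x i) / L - 7 / 3) ^ 2 := by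
  refine ⟨by rw [le_div_iff₀ hL]; exact h.1.le, ?_⟩
  have h1 : (∑ i, x i) / L - 7 / 3 = (∑ i, x i - 7 / 3 * L) / L := by field_simp
  rw [h1, div_pow, le_div_iff₀ (by positivity)]
  refine le_trans (le_of_eq ?_) h.2
  field_simp

theorem normalized_sq_add {n : ℕ} {L : ℝ} (hL : 0 < L) (Q S : ℝ) (hn : 0 < n) :
    (Q - S ^ 2 / n) / L + (S / L) ^ 2 / (n / L) = Q / L := by
  have : (0 : ℝ) < n := by exact_mod_cast hn
  field_simp
  ring

variable {𝒵 : Type*} [MeasurableSpace 𝒵] {n : ℕ} (P : Measure 𝒵) [IsProbabilityMeasure P]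

/-- Bernstein's inequality. -/
theorem bernstein {ξ : 𝒵 → ℝ} (hξ : Measurable ξ) (h1 : ∀ z, -1 ≤ ξ z) (h2 : ∀ z, ξ z ≤ 2)
    (h0 : ∫ z, ξ z ∂P = 0) {L r : ℝ} (hL : 0 < L) (hr : 0 < r)
    (hv : n * ∫ z, ξ z ^ 2 ∂P ≤ L * r ^ 2) :
    (Measure.pi fun _ : Fin n => P).real {d | L * (√2 * r + 2 / 3) ≤ ∑ i, ξ (d i)}
      ≤ Real.exp (-L) := by
  have hq : √2 ^ 2 = 2 := Real.sq_sqrt (by norm_num)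
  have hq0 : 0 < √2 := Real.sqrt_pos.2 (by norm_num)
  have hD : 0 < r + 2 / 3 * √2 := by positivity
  -- This choice makes the Chernoff exponent exactly `-L`.
  set l := √2 / (r + 2 / 3 * √2) with hl
  have hl0 : 0 < l := div_pos hq0 hD
  have hl1 : 1 - 2 * l / 3 = r / (r + 2 / 3 * √2) := by
    rw [hl]; field_simp; ring
  have hl2 : 0 < 1 - 2 * l / 3 := hl1 ▸ div_pos hr hD
  have hset : {d : Fin n → 𝒵 | L * (√2 * r + 2 / 3) ≤ ∑ i, ξ (d i)}
      = {d | l * (L * (√2 * r + 2 / 3)) ≤ ∑ i, l * ξ (d i)} := by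
    ext d
    simp only [Set.mem_ofPred_eq, ← Finset.mul_sum]
    exact (mul_le_mul_iff_right₀ hl0).symm
  rw [hset]
  have hk : 0 < l ^ 2 / (2 * (1 - 2 * l / 3)) := by positivity
  refine (chernoff_of_exp_le P (hξ.const_mul l) hξ (C := 2) (l := l)
    (k := l ^ 2 / (2 * (1 - 2 * l / 3))) (M := l ^ 2 / (2 * (1 - 2 * l / 3)) * (L * r ^ 2))
    (fun z => abs_le.2 ⟨by linarith [h1 z], h2 z⟩) h0 (fun z => ?_) ?_).trans ?_
  · refine (exp_le_of_le (b := 2 * l) (by nlinarith [h2 z]) (by linarith)).trans (le_of_eq ?_)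
    ring
  · rw [mul_left_comm]
    exact mul_le_mul_of_nonneg_left hv hk.le
  · rw [Real.exp_le_exp]
    refine le_of_eq ?_
    have h3 : l * (r + 2 / 3 * √2) = √2 := div_mul_cancel₀ _ hD.ne'
    have h4 : l ^ 2 / (2 * (1 - 2 * l / 3)) * (L * r ^ 2) = L * r * (l * √2) / 2 := by
      rw [hl1, hl]; field_simp
    have h5 : √2 * (l * (r + 2 / 3 * √2)) = 2 := by rw [h3, ← pow_two, hq]
    rw [h4]
    have h6 : √2 * √2 = 2 := by rw [← pow_two, hq]
    linear_combination (-L / 2) * h5 + (1 / 3) * L * l * h6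

/-- The factors `1 + 0.7 ξ` are positive with mean `1`, so their product is at least `exp L` with
probability at most `exp (-L)`. No variance information enters. -/
theorem deviates_small {ξ : 𝒵 → ℝ} (hξ : Measurable ξ) (h1 : ∀ z, -1 ≤ ξ z) (h2 : ∀ z, ξ z ≤ 2)
    (h0 : ∫ z, ξ z ∂P = 0) {L : ℝ} (hL : 0 < L) (hn : 0 < n) :
    (Measure.pi fun _ : Fin n => P).real
      {d | Deviates L (fun i => ξ (d i)) ∧ ∑ i, ξ (d i) ≤ L * 4.061} ≤ Real.exp (-L) := by
  have hsub : {d : Fin n → 𝒵 | Deviates L (fun i => ξ (d i)) ∧ ∑ i, ξ (d i) ≤ L * 4.061}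
      ⊆ {d | L ≤ ∑ i, Real.log (1 + 0.7 * ξ (d i))} := by
    rintro d ⟨hd, hs⟩
    have hS0 : 0 ≤ ∑ i, ξ (d i) := by have := hd.1; linarith
    have hS2 : ∑ i, ξ (d i) ≤ 2 * n := by
      refine (Finset.sum_le_sum fun i _ => h2 (d i)).trans (le_of_eq ?_)
      simp [mul_comm]
    refine le_trans ?_ (sum_fan_le hn (fun i => ξ (d i)) (fun i => h1 _) hS2 hS0)
    obtain ⟨h3, h4⟩ := hd.normalized hL
    have := mul_le_mul_of_nonneg_left
      (half_log_le_of_small h3 (by rw [div_le_iff₀ hL]; linarith) h4) hL.le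
    refine le_trans (by rw [mul_one]) (this.trans (le_of_eq ?_))
    have hL' := hL.ne'
    have h5 : ∀ a : ℝ, L * (a / L) = a := fun a => mul_div_cancel₀ a hL'
    linear_combination (1 / 2 * Real.log 2.4) * h5 (∑ i, ξ (d i))
      - 0.51 * h5 (∑ i, ξ (d i) ^ 2 - (∑ i, ξ (d i)) ^ 2 / n)
  refine (measureReal_mono hsub).trans ?_
  have := chernoff_of_exp_le (n := n) P (φ := fun z => Real.log (1 + 0.7 * ξ z)) (C := 2) (l := 0.7)
    (k := 0) (M := 0) (K := L) (Real.measurable_log.comp ((hξ.const_mul _).const_add _)) hξ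
    (fun z => abs_le.2 ⟨by linarith [h1 z], h2 z⟩) h0
    (fun z => by rw [Real.exp_log (by linarith [h1 z])]; linarith) (by simp)
  simpa using this

/-- By Fan's inequality `0.52 ξ - 0.215 ξ²` lies below `log (1 + 0.52 ξ)`, so its exponential has
mean at most `1`. -/
theorem deviates_medium {ξ : 𝒵 → ℝ} (hξ : Measurable ξ) (h1 : ∀ z, -1 ≤ ξ z) (h2 : ∀ z, ξ z ≤ 2)
    (h0 : ∫ z, ξ z ∂P = 0) {L r : ℝ} (hL : 0 < L) (hn : 0 < n) (hr1 : 2.4 ≤ r) (hr2 : r ≤ 3.8)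
    (hN : L * r ^ 2 ≤ n) :
    (Measure.pi fun _ : Fin n => P).real
      {d | Deviates L (fun i => ξ (d i)) ∧ ∑ i, ξ (d i) ≤ L * (√2 * r + 2 / 3)}
      ≤ Real.exp (-L) := by
  have hsub : {d : Fin n → 𝒵 | Deviates L (fun i => ξ (d i)) ∧
      ∑ i, ξ (d i) ≤ L * (√2 * r + 2 / 3)}
      ⊆ {d | L ≤ ∑ i, (0.52 * ξ (d i) - 0.215 * ξ (d i) ^ 2)} := by
    rintro d ⟨hd, hs⟩
    obtain ⟨h3, h4⟩ := hd.normalized hL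
    have := mul_le_mul_of_nonneg_left (quadratic_le_of_medium (N := n / L) hr1 hr2
      (by rw [le_div_iff₀ hL]; linarith) h3 (by rw [div_le_iff₀ hL]; linarith) h4) hL.le
    rw [normalized_sq_add hL _ _ hn] at this
    simp only [Set.mem_ofPred_eq]
    rw [Finset.sum_sub_distrib, ← Finset.mul_sum, ← Finset.mul_sum]
    refine le_trans (by rw [mul_one]) (this.trans (le_of_eq ?_))
    have h5 : ∀ a : ℝ, L * (a / L) = a := fun a => mul_div_cancel₀ a hL.ne'
    linear_combination 0.52 * h5 (∑ i, ξ (d i)) - 0.215 * h5 (∑ i, ξ (d i) ^ 2)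
  have hlog : -(Real.log (1 - 0.52) + 0.52) ≤ (0.215 : ℝ) := by
    have h3 : Real.log (1 - 0.52) = -(Real.log 2 + Real.log (25 / 24)) := by
      rw [← Real.log_mul (by norm_num) (by norm_num), ← Real.log_inv]; norm_num
    have h4 := Real.log_le_sub_one_of_pos (show (0 : ℝ) < 25 / 24 by norm_num)
    linarith [Real.log_two_lt_d9]
  refine (measureReal_mono hsub).trans ?_
  have := chernoff_of_exp_le (n := n) P (φ := fun z => 0.52 * ξ z - 0.215 * ξ z ^ 2) (C := 2)
    (l := 0.52) (k := 0) (M := 0) (K := L)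
    ((hξ.const_mul _).sub ((hξ.pow_const 2).const_mul _)) hξ
    (fun z => abs_le.2 ⟨by linarith [h1 z], h2 z⟩) h0
    (fun z => ?_) (by simp)
  · simpa using this
  · rw [zero_mul, add_zero, ← Real.le_log_iff_exp_le (by linarith [h1 z])]
    refine le_trans ?_ (fan_le_log (l := 0.52) (by norm_num) (by norm_num) (h1 z))
    nlinarith [mul_le_mul_of_nonneg_right hlog (sq_nonneg (ξ z))]

/-- Here the lower bound on the true variance does the work: `exp φ ≤ 1 + l ξ - l² ξ² / 2` with `l²
r² = 2` brings the exponential moment of the sum down to `exp (-L)`, so the event only has to force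
a nonnegative sum. -/
theorem deviates_large {ξ : 𝒵 → ℝ} (hξ : Measurable ξ) (h1 : ∀ z, -1 ≤ ξ z) (h2 : ∀ z, ξ z ≤ 2)
    (h0 : ∫ z, ξ z ∂P = 0) {L r : ℝ} (hL : 0 < L) (hn : 0 < n) (hr : 3.8 ≤ r)
    (hN : L * r ^ 2 ≤ n) (hv : L * r ^ 2 ≤ n * ∫ z, ξ z ^ 2 ∂P) :
    (Measure.pi fun _ : Fin n => P).real
      {d | Deviates L (fun i => ξ (d i)) ∧ ∑ i, ξ (d i) ≤ L * (√2 * r + 2 / 3)}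
      ≤ Real.exp (-L) := by
  have hq : √2 ^ 2 = 2 := Real.sq_sqrt (by norm_num)
  have hq0 : 0 < √2 := Real.sqrt_pos.2 (by norm_num)
  have hq1 : √2 ≤ 1.4143 := by nlinarith
  have hr0 : 0 < r := by linarith
  have hsub : {d : Fin n → 𝒵 | Deviates L (fun i => ξ (d i)) ∧
      ∑ i, ξ (d i) ≤ L * (√2 * r + 2 / 3)}
      ⊆ {d | 0 ≤ ∑ i, (√2 / r * ξ (d i)
        - (1 + 7 / 4 * (√2 / r)) * (√2 / r) ^ 2 * ξ (d i) ^ 2)} := by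
    rintro d ⟨hd, hs⟩
    obtain ⟨h3, h4⟩ := hd.normalized hL
    have := mul_nonneg hL.le (quadratic_nonneg_of_large (N := n / L) hr
      (by rw [le_div_iff₀ hL]; linarith) h3 (by rw [div_le_iff₀ hL]; linarith) h4)
    rw [normalized_sq_add hL _ _ hn] at this
    simp only [Set.mem_ofPred_eq]
    rw [Finset.sum_sub_distrib, ← Finset.mul_sum, ← Finset.mul_sum]
    refine this.trans (le_of_eq ?_)
    have h5 : ∀ a : ℝ, L * (a / L) = a := fun a => mul_div_cancel₀ a hL.ne'
    linear_combination √2 / r * h5 (∑ i, ξ (d i))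
      - (1 + 7 / 4 * (√2 / r)) * (√2 / r) ^ 2 * h5 (∑ i, ξ (d i) ^ 2)
  refine (measureReal_mono hsub).trans ?_
  set l := √2 / r with hl
  have hl0 : 0 < l := div_pos hq0 hr0
  have hl1 : l ≤ 3 / 8 := by rw [hl, div_le_iff₀ hr0]; linarith
  have hlr : l ^ 2 * r ^ 2 = 2 := by rw [← mul_pow, div_mul_cancel₀ _ hr0.ne', hq]
  have := chernoff_of_exp_le (n := n) P
    (φ := fun z => l * ξ z - (1 + 7 / 4 * l) * l ^ 2 * ξ z ^ 2) (C := 2)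
    (l := l) (k := -(l ^ 2 / 2)) (M := -L) (K := 0)
    ((hξ.const_mul _).sub ((hξ.pow_const 2).const_mul _)) hξ
    (fun z => abs_le.2 ⟨by linarith [h1 z], h2 z⟩) h0
    (fun z => ?_) ?_
  · simpa using this
  · set u := l * ξ z with hu
    have hu2 : l ^ 2 * ξ z ^ 2 = u ^ 2 := by rw [hu]; ring
    have hu3 : u ≤ 2 := by rw [hu]; nlinarith [h2 z]
    have hu4 : -l ≤ u := by rw [hu]; nlinarith [h1 z]
    have h5 : 1 + u + -(l ^ 2 / 2) * ξ z ^ 2 = 1 + u - u ^ 2 / 2 := by rw [← hu2]; ring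
    have h6 : u - (1 + 7 / 4 * l) * l ^ 2 * ξ z ^ 2 = u - (1 + 7 / 4 * l) * u ^ 2 := by
      rw [← hu2]; ring
    rw [h5, h6, ← Real.le_log_iff_exp_le (by nlinarith)]
    rcases le_total 0 u with h | h
    · refine le_trans ?_ (sub_sq_le_log h hu3)
      nlinarith [mul_nonneg hl0.le (sq_nonneg u)]
    -- Since `-u ≤ l`, the cubic term is at most `7/4 l u²`; this is the source of the factor `1 +
    -- 7/4 l`.
    · have h7 := neg_sub_sq_sub_cube_le_log (w := -u) (by linarith) (by linarith)
      rw [show 1 - -u - (-u) ^ 2 / 2 = 1 + u - u ^ 2 / 2 by ring] at h7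
      refine le_trans ?_ h7
      nlinarith [mul_nonneg (show 0 ≤ l + u by linarith) (sq_nonneg u)]
  · have h5 := mul_le_mul_of_nonneg_left hv (show 0 ≤ l ^ 2 / 2 by positivity)
    have h6 : l ^ 2 / 2 * (L * r ^ 2) = L := by linear_combination L / 2 * hlr
    linarith

theorem deviates_le {ξ : 𝒵 → ℝ} (hξ : Measurable ξ) (h1 : ∀ z, -1 ≤ ξ z) (h2 : ∀ z, ξ z ≤ 2)
    (h0 : ∫ z, ξ z ∂P = 0) (hv1 : ∫ z, ξ z ^ 2 ∂P ≤ 1) {L : ℝ} (hL : 0 < L) (hn : 0 < n) :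
    (Measure.pi fun _ : Fin n => P).real {d | Deviates L (fun i => ξ (d i))}
      ≤ 2 * Real.exp (-L) := by
  have hn' : (0 : ℝ) < n := by exact_mod_cast hn
  set v := n * ∫ z, ξ z ^ 2 ∂P with hv
  have hv0 : 0 ≤ v := mul_nonneg hn'.le (integral_nonneg fun z => sq_nonneg _)
  have hvn : v ≤ n := by rw [hv]; nlinarith
  -- The floor `1` keeps `r` positive for Bernstein. It is inactive once `r > 1`, where `L r² = v ≤
  -- n` supplies the hypotheses of the other two ranges.
  set r := √(max 1 (v / L)) with hr
  have hr2 : r ^ 2 = max 1 (v / L) := Real.sq_sqrt (by positivity)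
  have hr1 : 1 ≤ r := Real.one_le_sqrt.2 (le_max_left _ _)
  have hvr : v ≤ L * r ^ 2 := by
    rw [hr2, ← div_le_iff₀' hL]; exact le_max_right _ _
  have heq : 1 < r → L * r ^ 2 = v := by
    intro h
    rcases max_choice 1 (v / L) with h3 | h3
    · rw [h3] at hr2; nlinarith
    · rw [hr2, h3, mul_div_cancel₀ _ hL.ne']
  have hb := bernstein P hξ h1 h2 h0 hL (by linarith) hvr
  have hB : (Measure.pi fun _ : Fin n => P).real
      {d | Deviates L (fun i => ξ (d i)) ∧ ∑ i, ξ (d i) ≤ L * (√2 * r + 2 / 3)}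
      ≤ Real.exp (-L) := by
    rcases le_total r 2.4 with h | h
    · refine (measureReal_mono ?_).trans (deviates_small P hξ h1 h2 h0 hL hn)
      rintro d ⟨hd, hs⟩
      refine ⟨hd, hs.trans (mul_le_mul_of_nonneg_left ?_ hL.le)⟩
      have hq : √2 ^ 2 = 2 := Real.sq_sqrt (by norm_num)
      have hq1 : √2 ≤ 1.4143 := by nlinarith [Real.sqrt_nonneg 2]
      nlinarith
    · have h3 := heq (by linarith)
      rcases le_total r 3.8 with h4 | h4
      · exact deviates_medium P hξ h1 h2 h0 hL hn h h4 (h3.le.trans hvn)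
      · exact deviates_large P hξ h1 h2 h0 hL hn h4 (h3.le.trans hvn) h3.le
  have hsub : {d : Fin n → 𝒵 | Deviates L (fun i => ξ (d i))}
      ⊆ {d | L * (√2 * r + 2 / 3) ≤ ∑ i, ξ (d i)} ∪
        {d | Deviates L (fun i => ξ (d i)) ∧ ∑ i, ξ (d i) ≤ L * (√2 * r + 2 / 3)} := by
    intro d hd
    rcases le_total (L * (√2 * r + 2 / 3)) (∑ i, ξ (d i)) with h | h
    · exact Or.inl h
    · exact Or.inr ⟨hd, h⟩
  calc _ ≤ _ := measureReal_mono hsub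
    _ ≤ _ := measureReal_union_le _ _
    _ ≤ _ := by linarith

/-! ### From normalized sums to the empirical Bernstein radius. -/

open MEstimation

theorem sum_sub_empMean_sq {𝒵 : Type*} {n : ℕ} (hn : 0 < n) (d : Fin n → 𝒵) (f : 𝒵 → ℝ)
    {B c : ℝ} (hB : 0 < B) :
    ∑ i, (f (d i) - empMean d f) ^ 2
      = B ^ 2 * (∑ i, ((f (d i) - c) / B) ^ 2 - (∑ i, (f (d i) - c) / B) ^ 2 / n) := by
  have hn' : (0 : ℝ) < n := by exact_mod_cast hn
  set x : Fin n → ℝ := fun i => (f (d i) - c) / B with hx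
  change _ = B ^ 2 * (∑ i, x i ^ 2 - (∑ i, x i) ^ 2 / n)
  have hf : ∀ i, f (d i) = B * x i + c := fun i => by
    simp only [hx]; field_simp; ring
  have hmean : empMean d f = B * (∑ i, x i) / n + c := by
    rw [empMean]
    simp only [hf, Finset.sum_add_distrib, ← Finset.mul_sum, Finset.sum_const, Finset.card_univ,
      Fintype.card_fin, nsmul_eq_mul]
    field_simp
  have hterm : ∀ i, (f (d i) - empMean d f) ^ 2
      = B ^ 2 * x i ^ 2 - 2 * B ^ 2 * (∑ i, x i) / n * x i + B ^ 2 * (∑ i, x i) ^ 2 / n ^ 2 :=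
    fun i => by rw [hmean, hf]; ring
  simp only [hterm]
  rw [Finset.sum_add_distrib, Finset.sum_sub_distrib, ← Finset.mul_sum, ← Finset.mul_sum]
  simp only [Finset.sum_const, Finset.card_univ, Fintype.card_fin, nsmul_eq_mul]
  field_simp
  ring

/-- The real-valued empirical Bernstein radius, for `n ≥ 2`. -/
def realRadius {𝒵 : Type*} {n : ℕ} (B α : ℝ) (d : Fin n → 𝒵) (f : 𝒵 → ℝ) : ℝ :=
  √(2 * sampleVar d f * Real.log (2 / α) / n) + 7 * B * Real.log (2 / α) / (3 * ((n : ℝ) - 1))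

/-- Replacing `n - 1` by `n` only shrinks the radius, and in the units of `ξ` the shrunken radius
times `n` is `√(2 L V) + 7/3 L`. -/
theorem deviates_of_realRadius_lt {𝒵 : Type*} {n : ℕ} (hn : 2 ≤ n) (d : Fin n → 𝒵) (f : 𝒵 → ℝ)
    {B α c : ℝ} (hB : 0 < B) (hL : 0 < Real.log (2 / α))
    (h : realRadius B α d f < empMean d f - c) :
    Deviates (Real.log (2 / α)) (fun i => (f (d i) - c) / B) := by
  set L := Real.log (2 / α) with hLdef
  have hn' : (2 : ℝ) ≤ n := by exact_mod_cast hn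
  have hn0 : (0 : ℝ) < n := by linarith
  have hn1 : (0 : ℝ) < n - 1 := by linarith
  set S := ∑ i, (f (d i) - c) / B with hS
  set V := ∑ i, ((f (d i) - c) / B) ^ 2 - S ^ 2 / n with hV
  have hvar := sum_sub_empMean_sq (by omega) d f (c := c) hB
  rw [← hS, ← hV] at hvar
  have hV0 : 0 ≤ V := by
    have : 0 ≤ B ^ 2 * V := hvar ▸ Finset.sum_nonneg fun i _ => sq_nonneg _
    exact nonneg_of_mul_nonneg_right this (by positivity)
  have hmean : empMean d f - c = B * S / n := by
    rw [hS, ← Finset.sum_div, Finset.sum_sub_distrib, empMean]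
    simp only [Finset.sum_const, Finset.card_univ, Fintype.card_fin, nsmul_eq_mul]
    field_simp
  have hsv : sampleVar d f = B ^ 2 * V / (n - 1) := by
    rw [sampleVar, hvar]; ring
  have hrad : B / n * (√(2 * L * V) + 7 / 3 * L) ≤ realRadius B α d f := by
    have h1 : B / n * √(2 * L * V) ≤ √(2 * sampleVar d f * L / n) := by
      refine Real.le_sqrt_of_sq_le ?_
      rw [mul_pow, Real.sq_sqrt (by positivity), hsv]
      have e1 : (B / n) ^ 2 * (2 * L * V) = 2 * L * V * B ^ 2 / (n * n) := by field_simp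
      have e2 : 2 * (B ^ 2 * V / (n - 1)) * L / n = 2 * L * V * B ^ 2 / (n * (n - 1)) := by
        field_simp
      rw [e1, e2]
      exact div_le_div_of_nonneg_left (by positivity) (by positivity)
        (mul_le_mul_of_nonneg_left (by linarith) hn0.le)
    have h2 : B / n * (7 / 3 * L) ≤ 7 * B * L / (3 * ((n : ℝ) - 1)) := by
      have e1 : B / n * (7 / 3 * L) = 7 * B * L / (3 * n) := by field_simp
      rw [e1]
      exact div_le_div_of_nonneg_left (by positivity) (by positivity) (by linarith)
    rw [realRadius, mul_add]
    exact add_le_add h1 h2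
  have hlt : √(2 * L * V) + 7 / 3 * L < S := by
    have h3 := hrad.trans_lt h
    rw [hmean, show B * S / n = B / n * S by ring] at h3
    exact lt_of_mul_lt_mul_left h3 (by positivity)
  have hs0 := Real.sqrt_nonneg (2 * L * V)
  refine ⟨by linarith, ?_⟩
  change 2 * L * V ≤ (S - 7 / 3 * L) ^ 2
  rw [← Real.sqrt_le_left (by linarith)]
  linarith

/-- The one-sided empirical Bernstein inequality for a function with values in `[-B, B]` and
nonpositive mean. -/
theorem measure_realRadius_lt_le {𝒵 : Type*} [MeasurableSpace 𝒵] {n : ℕ} (hn : 2 ≤ n)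
    (P : Measure 𝒵) [IsProbabilityMeasure P] {f : 𝒵 → ℝ} (hf : Measurable f) {B α : ℝ}
    (hB : ∀ z, |f z| ≤ B) (hmean : ∫ z, f z ∂P ≤ 0) (hα0 : 0 < α) (hα1 : α < 1) :
    (Measure.pi fun _ : Fin n => P) {d | realRadius B α d f < empMean d f - ∫ z, f z ∂P}
      ≤ ENNReal.ofReal α := by
  have hL : 0 < Real.log (2 / α) := Real.log_pos (by rw [lt_div_iff₀ hα0]; linarith)
  have hB0 : 0 ≤ B := by
    obtain ⟨z⟩ := nonempty_of_isProbabilityMeasure P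
    exact (abs_nonneg _).trans (hB z)
  -- Normalization divides by `B`; if `B = 0` then `f = 0` and the event reads `0 < 0`.
  rcases hB0.eq_or_lt with hB0 | hB0
  · have hf0 : f = fun _ => 0 := by
      funext z
      exact abs_nonpos_iff.1 (hB0 ▸ hB z)
    have : {d : Fin n → 𝒵 | realRadius B α d f < empMean d f - ∫ z, f z ∂P} = ∅ := by
      ext d
      simp [hf0, realRadius, empMean, sampleVar, ← hB0]
    rw [this]
    simp
  set c := ∫ z, f z ∂P with hc
  have hi : Integrable f P :=
    Integrable.of_bound hf.aestronglyMeasurable B (Filter.Eventually.of_forall hB)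
  have hcB : -B ≤ c := by
    have : ∫ _, -B ∂P ≤ c := integral_mono (integrable_const _) hi fun z => (abs_le.1 (hB z)).1
    simpa using this
  have hi2 : Integrable (fun z => f z ^ 2) P := by
    refine Integrable.of_bound (hf.pow_const 2).aestronglyMeasurable (B ^ 2)
      (Filter.Eventually.of_forall fun z => ?_)
    rw [Real.norm_eq_abs, abs_pow]
    exact pow_le_pow_left₀ (abs_nonneg _) (hB z) 2
  have hξ0 : ∫ z, (f z - c) / B ∂P = 0 := by
    rw [integral_div, integral_sub hi (integrable_const _)]
    simp [hc]
  have hξ2 : ∫ z, ((f z - c) / B) ^ 2 ∂P ≤ 1 := by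
    have h1 : ∀ z, ((f z - c) / B) ^ 2 ≤ 1 + (-(2 * c) * f z + c ^ 2) / B ^ 2 := fun z => by
      have : f z ^ 2 ≤ B ^ 2 := sq_le_sq' (abs_le.1 (hB z)).1 (abs_le.1 (hB z)).2
      rw [div_pow, ← sub_le_iff_le_add, ← sub_div, div_le_one (by positivity)]
      nlinarith
    have h2 : Integrable (fun z => (-(2 * c) * f z + c ^ 2) / B ^ 2) P :=
      ((hi.const_mul _).add (integrable_const _)).div_const _
    have h3 : Integrable (fun z => 1 + (-(2 * c) * f z + c ^ 2) / B ^ 2) P :=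
      (integrable_const 1).add h2
    have h4 : ∫ z, (1 + (-(2 * c) * f z + c ^ 2) / B ^ 2) ∂P = 1 - c ^ 2 / B ^ 2 := by
      rw [integral_add (integrable_const 1) h2, integral_div,
        integral_add (hi.const_mul _) (integrable_const _), integral_const_mul, ← hc]
      simp
      ring
    refine (integral_mono_of_nonneg (Filter.Eventually.of_forall fun z => sq_nonneg _) h3
      (Filter.Eventually.of_forall h1)).trans ?_
    rw [h4]
    have : 0 ≤ c ^ 2 / B ^ 2 := by positivity
    linarith
  -- The lower bound `-1` uses that the mean `c` is nonpositive; the upper bound `2` uses `c ≥ -B`.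
  have hdev := deviates_le (n := n) P (ξ := fun z => (f z - c) / B) ((hf.sub_const c).div_const B)
    (fun z => by rw [le_div_iff₀ hB0]; linarith [(abs_le.1 (hB z)).1])
    (fun z => by rw [div_le_iff₀ hB0]; linarith [(abs_le.1 (hB z)).2]) hξ0 hξ2 hL (by omega)
  have hexp : 2 * Real.exp (-Real.log (2 / α)) = α := by
    rw [Real.exp_neg, Real.exp_log (by positivity)]; field_simp
  rw [hexp] at hdev
  rw [← ofReal_measureReal]
  refine ENNReal.ofReal_le_ofReal (le_trans (measureReal_mono fun d hd => ?_) hdev)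
  exact deviates_of_realRadius_lt hn d f hB0 hL hd

/-! ### Conditioning, sample splitting and coverage. -/

/-- A lower bound on a conditional probability given a sub-σ-algebra carries over to the
probability. Sets that are not null-measurable have conditional probability `0` by convention, so
null-measurability follows as soon as the bound is positive. -/
theorem nullMeasurable_and_le_of_le_condExp {Ω : Type*} {m m0 : MeasurableSpace Ω} (hm : m ≤ m0)
    {μ : Measure Ω} [IsProbabilityMeasure μ] {E : Set Ω} {p : ℝ} (hp : 0 < p)
    (h : ∀ᵐ ω ∂μ, p ≤ (μ⟦E | m⟧) ω) : NullMeasurableSet E μ ∧ p ≤ μ.real E := by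
  have hint : Integrable (E.indicator fun _ => (1 : ℝ)) μ := by
    by_contra hni
    rw [condExp_of_not_integrable hni] at h
    obtain ⟨ω, hω⟩ := h.exists
    exact absurd hω (not_le.2 hp)
  have hE : NullMeasurableSet E μ :=
    (aemeasurable_indicator_const_iff (1 : ℝ)).1 hint.aestronglyMeasurable.aemeasurable
  refine ⟨hE, ?_⟩
  calc p = ∫ _, p ∂μ := by simp
    _ ≤ ∫ ω, (μ⟦E | m⟧) ω ∂μ := integral_mono_ae (integrable_const _) integrable_condExp h
    _ = ∫ ω, E.indicator (fun _ => (1 : ℝ)) ω ∂μ := integral_condExp hm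
    _ = μ.real E := by
      rw [integral_indicator₀ hE]
      simp

theorem measurable_realRadius {𝒵 𝒲 : Type*} [MeasurableSpace 𝒵] [MeasurableSpace 𝒲] {n : ℕ}
    (B α : ℝ) {F : 𝒲 → 𝒵 → ℝ} (hF : Measurable fun q : 𝒲 × 𝒵 => F q.1 q.2) :
    Measurable fun q : 𝒲 × (Fin n → 𝒵) => realRadius B α q.2 (F q.1) := by
  have h1 : ∀ i : Fin n, Measurable fun q : 𝒲 × (Fin n → 𝒵) => F q.1 (q.2 i) := fun i =>
    hF.comp (measurable_fst.prodMk ((measurable_pi_apply i).comp measurable_snd))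
  unfold realRadius sampleVar empMean
  fun_prop

theorem measurable_empMean {𝒵 𝒲 : Type*} [MeasurableSpace 𝒵] [MeasurableSpace 𝒲] {n : ℕ}
    {F : 𝒲 → 𝒵 → ℝ} (hF : Measurable fun q : 𝒲 × 𝒵 => F q.1 q.2) :
    Measurable fun q : 𝒲 × (Fin n → 𝒵) => empMean q.2 (F q.1) := by
  have h1 : ∀ i : Fin n, Measurable fun q : 𝒲 × (Fin n → 𝒵) => F q.1 (q.2 i) := fun i =>
    hF.comp (measurable_fst.prodMk ((measurable_pi_apply i).comp measurable_snd))
  unfold empMean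
  fun_prop

/-- A bound that holds for every value of the first of two independent samples holds
unconditionally. -/
theorem measure_split_le {𝒵 Ω : Type*} [MeasurableSpace 𝒵] [MeasurableSpace Ω] {n₁ n : ℕ}
    {D₁ : Fin n₁ → Ω → 𝒵} {D₂ : Fin n → Ω → 𝒵} {μ : Measure Ω} [IsProbabilityMeasure μ]
    {P : Measure 𝒵} (h : IsSplitSample D₁ D₂ μ P)
    {J : Set ((Fin n₁ → 𝒵) × (Fin n → 𝒵))} (hJ : MeasurableSet J) {a : ℝ≥0∞}
    (ha : ∀ x, (Measure.pi fun _ : Fin n => P) (Prod.mk x ⁻¹' J) ≤ a) :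
    μ {ω | ((fun i => D₁ i ω), (fun i => D₂ i ω)) ∈ J} ≤ a := by
  have hm1 : Measurable fun ω i => D₁ i ω := measurable_pi_lambda _ h.measurable_fst
  have hm2 : Measurable fun ω i => D₂ i ω := measurable_pi_lambda _ h.measurable_snd
  have hlaw2 : μ.map (fun ω i => D₂ i ω) = Measure.pi fun _ => P := by
    rw [h.iIndep_snd.map_fun_eq_pi_map fun i => (h.measurable_snd i).aemeasurable]
    simp only [h.law_snd]
  have hlaw := h.indep.map_prod_eq_prod_map_map hm1.aemeasurable hm2.aemeasurable
  have hp1 := Measure.isProbabilityMeasure_map (μ := μ) hm1.aemeasurable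
  have hp2 := Measure.isProbabilityMeasure_map (μ := μ) hm2.aemeasurable
  calc μ {ω | ((fun i => D₁ i ω), (fun i => D₂ i ω)) ∈ J}
      = μ.map (fun ω => ((fun i => D₁ i ω), (fun i => D₂ i ω))) J :=
        (Measure.map_apply (hm1.prodMk hm2) hJ).symm
    _ = ∫⁻ x, (Measure.pi fun _ : Fin n => P) (Prod.mk x ⁻¹' J)
          ∂μ.map (fun ω i => D₁ i ω) := by
        rw [hlaw, Measure.prod_apply hJ, hlaw2]
    _ ≤ ∫⁻ _, a ∂μ.map (fun ω i => D₁ i ω) := lintegral_mono ha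
    _ = a := by simp

theorem le_measure_ebConfidenceSet {𝒵 Θ Ω : Type*} [MeasurableSpace 𝒵] [MeasurableSpace Ω]
    {m : Θ → 𝒵 → ℝ} {P : Measure 𝒵} [IsProbabilityMeasure P] (hm : ∀ θ, Measurable (m θ))
    (hint : ∀ θ, Integrable (m θ) P) {B : ℝ} (hB : ∀ θ₁ θ₂ z, |m θ₁ z - m θ₂ z| ≤ B)
    {n₁ n : ℕ} {D₁ : Fin n₁ → Ω → 𝒵} {D₂ : Fin n → Ω → 𝒵}
    {μ : Measure Ω} [IsProbabilityMeasure μ] (hD : IsSplitSample D₁ D₂ μ P)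
    {θhat : (Fin n₁ → 𝒵) → Θ}
    (hθhat : Measurable (fun q : (Fin n₁ → 𝒵) × 𝒵 => m (θhat q.1) q.2))
    {α₁ α₂ : ℝ} (hα₁ : α₁ ∈ Set.Ioo (0 : ℝ) 1) (hα₂ : α₂ < 1)
    {U : Θ → Θ → (Fin n → 𝒵) → ℝ} {θstar : Θ} (hθstar : θstar ∈ argminRisk m P)
    (hU : ∀ᵐ ω ∂μ, 1 - α₂ ≤
      (μ⟦{ω' | - excessRisk m P θstar (θhat (fun i => D₁ i ω'))
        ≤ U θstar (θhat (fun i => D₁ i ω')) (fun i => D₂ i ω')} | dataSigma D₁⟧) ω) :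
    ENNReal.ofReal (1 - α₁ - α₂) ≤ μ {ω | θstar ∈ ebConfidenceSet m B α₁ U
      (θhat (fun i => D₁ i ω)) (fun i => D₂ i ω)} := by
  have hα1 := hα₁.1
  obtain ⟨hE, hpE⟩ := nullMeasurable_and_le_of_le_condExp
    (measurable_pi_lambda _ hD.measurable_fst).comap_le (by linarith) hU
  set E := {ω' | - excessRisk m P θstar (θhat (fun i => D₁ i ω'))
        ≤ U θstar (θhat (fun i => D₁ i ω')) (fun i => D₂ i ω')} with hEdef
  rcases le_or_gt n 1 with hn | hn
  · refine le_trans (ENNReal.ofReal_le_ofReal (by linarith))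
      ((ENNReal.ofReal_le_of_le_toReal hpE).trans (measure_mono fun ω _ => ?_))
    rw [Set.mem_ofPred_eq, ebConfidenceSet, Set.mem_ofPred_eq, ebRadius, if_pos hn, EReal.top_add_coe]
    exact le_top
  set F : (Fin n₁ → 𝒵) → 𝒵 → ℝ := fun x z => m θstar z - m (θhat x) z with hF
  have hFm : Measurable fun q : (Fin n₁ → 𝒵) × 𝒵 => F q.1 q.2 :=
    ((hm θstar).comp measurable_snd).sub hθhat
  have hFint : ∀ x, ∫ z, F x z ∂P = -excessRisk m P θstar (θhat x) := fun x => by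
    rw [hF, integral_sub (hint _) (hint _), excessRisk, risk, risk]
    ring
  set J : Set ((Fin n₁ → 𝒵) × (Fin n → 𝒵)) :=
    {q | realRadius B α₁ q.2 (F q.1) < empMean q.2 (F q.1) - ∫ z, F q.1 z ∂P} with hJ
  have hJm : MeasurableSet J := by
    refine measurableSet_lt (measurable_realRadius B α₁ hFm) ((measurable_empMean hFm).sub ?_)
    exact (hFm.stronglyMeasurable.integral_prod_right'.measurable).comp measurable_fst
  have hJle := measure_split_le hD hJm (a := ENNReal.ofReal α₁) fun x =>
    measure_realRadius_lt_le hn P (f := F x) ((hm _).sub (hm _)) (fun z => hB _ _ z)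
      (by rw [hFint, excessRisk]; linarith [hθstar (θhat x)]) hα₁.1 hα₁.2
  set A := {ω | ((fun i => D₁ i ω), (fun i => D₂ i ω)) ∈ J} with hA
  have hsub : E \ A ⊆ {ω | θstar ∈ ebConfidenceSet m B α₁ U
      (θhat (fun i => D₁ i ω)) (fun i => D₂ i ω)} := by
    rintro ω ⟨hωE, hωA⟩
    rw [Set.mem_ofPred_eq, ebConfidenceSet, Set.mem_ofPred_eq, ebRadius, if_neg (by omega), ← EReal.coe_add, EReal.coe_le_coe_iff]
    rw [hA, hJ, Set.mem_ofPred_eq, Set.mem_ofPred_eq, not_lt] at hωA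
    have h2 : excessRisk m P θstar (θhat fun i => D₁ i ω) ≥ 0 := by
      rw [excessRisk]; linarith [hθstar (θhat fun i => D₁ i ω)]
    -- Both terms of the minimum bound the mean of `F`: `0` because `θstar` is a minimizer, `U`
    -- because `ω ∈ E`.
    have h3 : -excessRisk m P θstar (θhat fun i => D₁ i ω)
        ≤ min 0 (U θstar (θhat fun i => D₁ i ω) fun i => D₂ i ω) :=
      le_min (by linarith) hωE
    rw [hFint, sub_le_iff_le_add] at hωA
    exact hωA.trans (add_le_add_right h3 _)
  calc ENNReal.ofReal (1 - α₁ - α₂) = ENNReal.ofReal (1 - α₂) - ENNReal.ofReal α₁ := by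
        rw [← ENNReal.ofReal_sub _ hα1.le]; congr 1; ring
    _ ≤ μ E - μ A := tsub_le_tsub (ENNReal.ofReal_le_of_le_toReal hpE) hJle
    -- This holds for arbitrary sets, so the coverage event need not be measurable.
    _ ≤ μ (E \ A) := le_measure_sdiff
    _ ≤ _ := measure_mono hsub

end EmpiricalBernstein

end

theorem mainTheorem3 {𝒵 Θ Ω : Type*} [MeasurableSpace 𝒵] [MeasurableSpace Ω]
    (m : Θ → 𝒵 → ℝ) (𝓟 : Set (ProbabilityMeasure 𝒵))
    (hm : ∀ θ, Measurable (m θ))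
    (hint : ∀ P ∈ 𝓟, ∀ θ, Integrable (m θ) (P : Measure 𝒵))
    (B₀ : ℝ) (hB₀ : ∀ θ₁ θ₂ z, |m θ₁ z - m θ₂ z| ≤ B₀)
    (n₁ n : ℕ) (hn : 1 ≤ n)
    (D₁ : Fin n₁ → Ω → 𝒵) (D₂ : Fin n → Ω → 𝒵)
    (Pr : ProbabilityMeasure 𝒵 → Measure Ω) (hPr : ∀ P ∈ 𝓟, IsProbabilityMeasure (Pr P))
    (hD : ∀ P ∈ 𝓟, MEstimation.IsSplitSample D₁ D₂ (Pr P) (P : Measure 𝒵))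
    (θhat : (Fin n₁ → 𝒵) → Θ)
    (hθhat : Measurable (fun q : (Fin n₁ → 𝒵) × 𝒵 => m (θhat q.1) q.2))
    (α₁ α₂ : ℝ) (hα₁ : α₁ ∈ Set.Ioo (0 : ℝ) 1) (hα₂ : α₂ ∈ Set.Ioo (0 : ℝ) 1)
    (U : Θ → Θ → (Fin n → 𝒵) → ℝ)
    (hU : MEstimation.IsUpperConfidenceBound m 𝓟 Pr D₁ D₂ θhat U α₂) :
    ENNReal.ofReal (1 - α₁ - α₂) ≤
      ⨅ P ∈ 𝓟, ⨅ θstar ∈ MEstimation.argminRisk m (P : Measure 𝒵),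
        Pr P {ω | θstar ∈ MEstimation.ebConfidenceSet m B₀ α₁ U
          (θhat (fun i => D₁ i ω)) (fun i => D₂ i ω)} := by
  refine le_iInf₂ fun P hP => le_iInf₂ fun θstar hθstar => ?_
  have := hPr P hP
  exact EmpiricalBernstein.le_measure_ebConfidenceSet hm (hint P hP) hB₀ (hD P hP) hθhat hα₁
    hα₂.2 hθstar (hU P hP θstar hθstar)
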